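/- An MV-algebra $(A,\oplus,{}^*,0)$ is an Abelian monoid $(A,\oplus,0)$ with a unary operation such that $x^{**}=x$, $0^*\oplus x=0^*$ and $(x^*\oplus y)^*\oplus y=(y^*\oplus x)^*\oplus x$; put $1=0^*$ and $x\odot y=(x^*\oplus y^*)^*$. The standard example is $[0,1]$ with $x\oplus y=\min(1,x+y)$, $x^*=1-x$. Let $P=[0,1]\cap\mathbb Q$ or $P=[0,1]$. A DMV-algebra (for $P=[0,1]\cap\mathbb Q$), respectively a Riesz MV-algebra (for $P=[0,1]$), is an MV-algebra with unary operations $x\mapsto rx$, $r\in P$, satisfying $r(x\odot y^*)=(rx)\odot(ry)^*$, $(r\odot q^*)x=(rx)\odot(qx)^*$, $r(qx)=(rq)x$, $1x=x$; homomorphisms preserve all operations. An algebra of one of these three kinds is finitely presented if it is a quotient, by a principal ideal, of the free algebra of that kind on finitely many generators. The free algebra on $n$ generators is the algebra of functions $[0,1]^n\to[0,1]$ generated by the coordinate projections. For a finitely presented MV-algebra $A$ let $P\otimes A$ be the semisimple tensor product, that is, the semisimple MV-algebra through which every bimorphism from $P\times A$ to a semisimple MV-algebra factors uniquely, with scalar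 multiplication determined by $r(s\otimes a)=(rs)\otimes a$, and let $\iota_A\colon A\to P\otimes A$, $\iota_A(a)=1\otimes a$. Write $\mathcal D_\otimes(A)=([0,1]\cap\mathbb Q)\otimes A$ and $\mathcal T_\otimes(A)=[0,1]\otimes A$. Let $\mathbf{MV_{fp}}$ be the category of finitely presented MV-algebras and MV-homomorphisms. Let $\mathbf{DMV_{fp}'}$ be the category with objects $\mathcal D_\otimes(A)$, $A$ a finitely presented MV-algebra, and with morphisms the DMV-homomorphisms $g\colon\mathcal D_\otimes(A)\to\mathcal D_\otimes(B)$ such that $g(\iota_A(A))\subseteq\iota_B(B)$. Let $\mathbf{RMV_{fp}'}$ be the category with objects $\mathcal T_\otimes(A)$, $A$ a finitely presented MV-algebra, and with morphisms the Riesz MV-homomorphisms $g\colon\mathcal T_\otimes(A)\to\mathcal T_\otimes(B)$ such that $g(\iota_A(A))\subseteq\iota_B(B)$. Proposition. For every finitely presented MV-algebra $A$, the DMV-algebra $\mathcal D_\otimes(A)$ and the Riesz MV-algebra $\mathcal T_\otimes(A)$ are finitely presented, so that $\mathbf{DMV_{fp}'}$ and $\mathbf{RMV_{fp}'}$ are subcategories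 of the categories of finitely presented DMV-algebras and finitely presented Riesz MV-algebras. The categories $\mathbf{MV_{fp}}$, $\mathbf{DMV_{fp}'}$ and $\mathbf{RMV_{fp}'}$ are equivalent. -/

import Mathlib

open CategoryTheory

universe u v w

/-! ### MV-algebras -/

/-- An MV-algebra: an Abelian monoid `(A, +, 0)` (the operation `⊕` of Łukasiewicz logic is
written `+`) with an operation `mvNeg` such that `x** = x`, `0* ⊕ x = 0*` and
`(x* ⊕ y)* ⊕ y = (y* ⊕ x)* ⊕ x`. -/
class MVAlgebra (A : Type u) extends AddCommMonoid A where
  mvNeg : A → A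
  mvNeg_mvNeg : ∀ x : A, mvNeg (mvNeg x) = x
  mvNeg_zero_add : ∀ x : A, mvNeg 0 + x = mvNeg 0
  mvNeg_add_comm : ∀ x y : A, mvNeg (mvNeg x + y) + y = mvNeg (mvNeg y + x) + x

namespace MVAlgebra

variable {A : Type u} [MVAlgebra A]

/-- `1 = 0*`. -/
def mvOne : A := mvNeg 0

/-- `x ⊙ y = (x* ⊕ y*)*`. -/
def odot (x y : A) : A := mvNeg (mvNeg x + mvNeg y)

/-- `x ∨ y = x ⊕ (y ⊙ x*)`. -/
def mvSup (x y : A) : A := x + odot y (mvNeg x)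

/-- `x ∧ y = (x* ∨ y*)*`. -/
def mvInf (x y : A) : A := mvNeg (mvSup (mvNeg x) (mvNeg y))

/-- The natural order of an MV-algebra. -/
def mvLe (x y : A) : Prop := mvSup x y = y

/-- Chang's distance `d(x, y) = (x* ⊙ y) ⊕ (x ⊙ y*)`. -/
def mvDist (x y : A) : A := odot (mvNeg x) y + odot x (mvNeg y)

/-- The principal ideal `(a] = {x | x ≤ n a for some n}`, where `n a = a ⊕ ⋯ ⊕ a`. -/
def mvIdeal (a : A) : Set A := {x | ∃ n : ℕ, mvLe x (n • a)}

end MVAlgebra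

open MVAlgebra

/-- Homomorphisms of MV-algebras. -/
structure MVHom (A : Type u) (B : Type v) [MVAlgebra A] [MVAlgebra B] where
  toFun : A → B
  map_zero : toFun 0 = 0
  map_add : ∀ x y, toFun (x + y) = toFun x + toFun y
  map_neg : ∀ x, toFun (mvNeg x) = mvNeg (toFun x)

/-! ### Scalars, and MV-algebras with scalar multiplication -/

noncomputable instance unitInterval.instAddMV : Add unitInterval where
  add x y := ⟨min 1 ((x : ℝ) + y), le_min zero_le_one (add_nonneg x.2.1 y.2.1), min_le_left _ _⟩

/-- The standard MV-algebra `[0,1]`: `x ⊕ y = min (1, x + y)` and `x* = 1 - x`. -/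
noncomputable instance unitInterval.instMVAlgebra : MVAlgebra unitInterval where
  nsmul := nsmulRec
  add_assoc x y z := by
    apply Subtype.ext
    change min 1 (min 1 ((x : ℝ) + y) + z) = min 1 ((x : ℝ) + min 1 ((y : ℝ) + z))
    have hx := x.2.1
    have hz := z.2.1
    simp only [min_def]
    split_ifs <;> linarith
  zero_add x := by
    apply Subtype.ext
    change min 1 ((0 : ℝ) + x) = x
    rw [zero_add]
    exact min_eq_right x.2.2
  add_zero x := by
    apply Subtype.ext
    change min 1 ((x : ℝ) + 0) = x
    rw [add_zero]
    exact min_eq_right x.2.2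
  add_comm x y := by
    apply Subtype.ext
    change min 1 ((x : ℝ) + y) = min 1 ((y : ℝ) + x)
    rw [add_comm]
  mvNeg x := ⟨1 - (x : ℝ), sub_nonneg.2 x.2.2, sub_le_self _ x.2.1⟩
  mvNeg_mvNeg x := by
    apply Subtype.ext
    change 1 - (1 - (x : ℝ)) = x
    ring
  mvNeg_zero_add x := by
    apply Subtype.ext
    change min 1 (1 - (0 : ℝ) + x) = 1 - 0
    rw [sub_zero]
    exact min_eq_left (le_add_of_nonneg_right x.2.1)
  mvNeg_add_comm x y := by
    apply Subtype.ext
    change min 1 (1 - min 1 (1 - (x : ℝ) + y) + y) = min 1 (1 - min 1 (1 - (y : ℝ) + x) + x)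
    have hx := x.2.2
    have hy := y.2.2
    simp only [min_def]
    split_ifs <;> linarith

namespace unitInterval

theorem mv_coe_add (x y : unitInterval) : ((x + y : unitInterval) : ℝ) = min 1 ((x : ℝ) + y) := rfl

theorem mv_coe_neg (x : unitInterval) : ((mvNeg x : unitInterval) : ℝ) = 1 - x := rfl

theorem mv_coe_zero : ((0 : unitInterval) : ℝ) = 0 := rfl

theorem mv_coe_one : ((mvOne : unitInterval) : ℝ) = 1 := by
  change 1 - (0 : ℝ) = 1
  ring

theorem mv_coe_odot (x y : unitInterval) :
    ((odot x y : unitInterval) : ℝ) = max 0 ((x : ℝ) + y - 1) := by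
  change 1 - min 1 (1 - (x : ℝ) + (1 - y)) = max 0 ((x : ℝ) + y - 1)
  simp only [min_def, max_def]
  split_ifs <;> linarith

theorem mv_coe_inf (x y : unitInterval) : ((mvInf x y : unitInterval) : ℝ) = min (x : ℝ) y := by
  have h1 := x.2.2
  have h2 := y.2.2
  have h3 := x.2.1
  have h4 := y.2.1
  simp only [mvInf, mvSup, mv_coe_neg, mv_coe_add, mv_coe_odot]
  simp only [min_def, max_def]
  split_ifs <;> linarith

end unitInterval

/-- The scalars `[0,1] ∩ K`, for a field `K` of real numbers. -/
def Scalars (K : Subfield ℝ) : Type := {r : unitInterval // (r : ℝ) ∈ K}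

namespace Scalars

variable {K : Subfield ℝ}

/-- The inclusion of the scalars in `[0,1]`. -/
def val (r : Scalars K) : unitInterval := r.1

theorem ext {r s : Scalars K} (h : r.val = s.val) : r = s := Subtype.ext h

noncomputable instance : Zero (Scalars K) := ⟨⟨0, K.zero_mem⟩⟩

noncomputable instance : Add (Scalars K) where
  add r s := ⟨r.1 + s.1, by
    rw [unitInterval.mv_coe_add]
    rcases min_choice (1 : ℝ) ((r.1 : ℝ) + s.1) with h | h <;> rw [h]
    · exact K.one_mem
    · exact K.add_mem r.2 s.2⟩

/-- `[0,1] ∩ K` is an MV-subalgebra of `[0,1]`. -/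
noncomputable instance : MVAlgebra (Scalars K) where
  nsmul := nsmulRec
  add_assoc r s t := Subtype.ext (add_assoc r.1 s.1 t.1)
  zero_add r := Subtype.ext (zero_add r.1)
  add_zero r := Subtype.ext (add_zero r.1)
  add_comm r s := Subtype.ext (add_comm r.1 s.1)
  mvNeg r := ⟨mvNeg r.1, K.sub_mem K.one_mem r.2⟩
  mvNeg_mvNeg r := Subtype.ext (mvNeg_mvNeg r.1)
  mvNeg_zero_add r := Subtype.ext (mvNeg_zero_add r.1)
  mvNeg_add_comm r s := Subtype.ext (mvNeg_add_comm r.1 s.1)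

/-- The product of real numbers on `[0,1] ∩ K`. -/
noncomputable instance : Mul (Scalars K) := ⟨fun r s => ⟨r.1 * s.1, K.mul_mem r.2 s.2⟩⟩

theorem val_add (r s : Scalars K) : (r + s).val = r.val + s.val := rfl

theorem val_neg (r : Scalars K) : (mvNeg r).val = mvNeg r.val := rfl

theorem val_mul (r s : Scalars K) : (r * s).val = r.val * s.val := rfl

theorem val_zero : (0 : Scalars K).val = 0 := rfl

theorem val_one : (mvOne : Scalars K).val = mvOne := rfl

theorem val_odot (r s : Scalars K) : (odot r s).val = odot r.val s.val := rfl

end Scalars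

/-- An MV-algebra with a scalar multiplication by the elements of `[0,1] ∩ K`. For `K = ℝ` these
are the Riesz MV-algebras, for `K = ℚ` the DMV-algebras. -/
class ScalarMVAlgebra (K : Subfield ℝ) (A : Type u) [MVAlgebra A] extends SMul (Scalars K) A where
  smul_odot_neg : ∀ (r : Scalars K) (x y : A), r • odot x (mvNeg y) = odot (r • x) (mvNeg (r • y))
  odot_neg_smul : ∀ (r q : Scalars K) (x : A), odot r (mvNeg q) • x = odot (r • x) (mvNeg (q • x))
  smul_smul' : ∀ (r q : Scalars K) (x : A), r • q • x = (r * q) • x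
  one_smul' : ∀ x : A, (mvOne : Scalars K) • x = x

/-- The field of real numbers, as a subfield of itself: its scalars are `[0,1]`. -/
noncomputable def realScalars : Subfield ℝ := ⊤

/-- The field of rational numbers, as a subfield of `ℝ`: its scalars are `[0,1] ∩ ℚ`. -/
noncomputable def ratScalars : Subfield ℝ := (algebraMap ℚ ℝ).fieldRange

/-- Riesz MV-algebras. -/
abbrev RieszMVAlgebra (A : Type u) [MVAlgebra A] := ScalarMVAlgebra realScalars A

/-- DMV-algebras. -/
abbrev DMVAlgebra (A : Type u) [MVAlgebra A] := ScalarMVAlgebra ratScalars A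

/-- Homomorphisms of MV-algebras with scalar multiplication. -/
structure ScalarMVHom (K : Subfield ℝ) (A : Type u) (B : Type v) [MVAlgebra A] [MVAlgebra B]
    [ScalarMVAlgebra K A] [ScalarMVAlgebra K B] extends MVHom A B where
  map_smul : ∀ (r : Scalars K) (x : A), toFun (r • x) = r • toFun x

/-- The standard scalar multiplication on `[0,1]`: the product of real numbers. -/
noncomputable instance unitInterval.instScalarMVAlgebra (K : Subfield ℝ) :
    ScalarMVAlgebra K unitInterval where
  smul r x := r.val * x
  smul_odot_neg r x y := by
    apply Subtype.ext
    change ((r.val * odot x (mvNeg y) : unitInterval) : ℝ)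
      = (odot (r.val * x) (mvNeg (r.val * y)) : unitInterval)
    have hr := r.val.2.1
    rw [unitInterval.mv_coe_odot, unitInterval.mv_coe_neg]
    simp only [Set.Icc.coe_mul]
    rw [unitInterval.mv_coe_odot, unitInterval.mv_coe_neg, mul_max_of_nonneg _ _ hr]
    ring_nf
  odot_neg_smul r q x := by
    apply Subtype.ext
    change (((odot r (mvNeg q)).val * x : unitInterval) : ℝ)
      = (odot (r.val * x) (mvNeg (q.val * x)) : unitInterval)
    rw [unitInterval.mv_coe_odot, unitInterval.mv_coe_neg, Scalars.val_odot, Scalars.val_neg]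
    simp only [Set.Icc.coe_mul]
    rw [unitInterval.mv_coe_odot, unitInterval.mv_coe_neg, max_mul_of_nonneg _ _ x.2.1]
    ring_nf
  smul_smul' r q x := (mul_assoc r.val q.val x).symm
  one_smul' x := by
    apply Subtype.ext
    change (((mvOne : unitInterval) * x : unitInterval) : ℝ) = x
    rw [Set.Icc.coe_mul, unitInterval.mv_coe_one, one_mul]

theorem unitInterval.mv_coe_smul {K : Subfield ℝ} (r : Scalars K) (x : unitInterval) :
    ((r • x : unitInterval) : ℝ) = (r.val : ℝ) * x := rfl

/-! ### Algebras of functions and generated subalgebras -/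

/-- Functions with values in an MV-algebra, with pointwise operations. -/
instance Pi.instMVAlgebra (X : Type u) (A : Type v) [MVAlgebra A] : MVAlgebra (X → A) where
  mvNeg f x := mvNeg (f x)
  mvNeg_mvNeg f := funext fun x => mvNeg_mvNeg (f x)
  mvNeg_zero_add f := funext fun x => mvNeg_zero_add (f x)
  mvNeg_add_comm f g := funext fun x => mvNeg_add_comm (f x) (g x)

instance Pi.instScalarMVAlgebra (K : Subfield ℝ) (X : Type u) (A : Type v) [MVAlgebra A]
    [ScalarMVAlgebra K A] : ScalarMVAlgebra K (X → A) where
  smul r f x := r • f x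
  smul_odot_neg r f g := funext fun x => ScalarMVAlgebra.smul_odot_neg r (f x) (g x)
  odot_neg_smul r q f := funext fun x => ScalarMVAlgebra.odot_neg_smul r q (f x)
  smul_smul' r q f := funext fun x => ScalarMVAlgebra.smul_smul' r q (f x)
  one_smul' f := funext fun x => ScalarMVAlgebra.one_smul' (K := K) (f x)

/-- The MV-subalgebra generated by a set `s`. -/
inductive MVClosure {A : Type u} [MVAlgebra A] (s : Set A) : A → Prop
  | of (x : A) : x ∈ s → MVClosure s x
  | zero : MVClosure s 0
  | add (x y : A) : MVClosure s x → MVClosure s y → MVClosure s (x + y)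
  | neg (x : A) : MVClosure s x → MVClosure s (mvNeg x)

/-- The subalgebra, closed under scalar multiplication, generated by a set `s`. -/
inductive ScalarMVClosure (K : Subfield ℝ) {A : Type u} [MVAlgebra A] [ScalarMVAlgebra K A]
    (s : Set A) : A → Prop
  | of (x : A) : x ∈ s → ScalarMVClosure K s x
  | zero : ScalarMVClosure K s 0
  | add (x y : A) : ScalarMVClosure K s x → ScalarMVClosure K s y → ScalarMVClosure K s (x + y)
  | neg (x : A) : ScalarMVClosure K s x → ScalarMVClosure K s (mvNeg x)
  | smul (r : Scalars K) (x : A) : ScalarMVClosure K s x → ScalarMVClosure K s (r • x)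

instance {A : Type u} [MVAlgebra A] (s : Set A) : Zero {x : A // MVClosure s x} := ⟨⟨0, .zero⟩⟩

instance {A : Type u} [MVAlgebra A] (s : Set A) : Add {x : A // MVClosure s x} where
  add x y := ⟨x.1 + y.1, .add _ _ x.2 y.2⟩

instance instMVAlgebraMVClosure {A : Type u} [MVAlgebra A] (s : Set A) :
    MVAlgebra {x : A // MVClosure s x} where
  nsmul := nsmulRec
  add_assoc x y z := Subtype.ext (add_assoc x.1 y.1 z.1)
  zero_add x := Subtype.ext (zero_add x.1)
  add_zero x := Subtype.ext (add_zero x.1)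
  add_comm x y := Subtype.ext (add_comm x.1 y.1)
  mvNeg x := ⟨mvNeg x.1, .neg _ x.2⟩
  mvNeg_mvNeg x := Subtype.ext (mvNeg_mvNeg x.1)
  mvNeg_zero_add x := Subtype.ext (mvNeg_zero_add x.1)
  mvNeg_add_comm x y := Subtype.ext (mvNeg_add_comm x.1 y.1)

instance (K : Subfield ℝ) {A : Type u} [MVAlgebra A] [ScalarMVAlgebra K A] (s : Set A) :
    Zero {x : A // ScalarMVClosure K s x} := ⟨⟨0, .zero⟩⟩

instance (K : Subfield ℝ) {A : Type u} [MVAlgebra A] [ScalarMVAlgebra K A] (s : Set A) :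
    Add {x : A // ScalarMVClosure K s x} where
  add x y := ⟨x.1 + y.1, .add _ _ x.2 y.2⟩

instance instMVAlgebraScalarMVClosure (K : Subfield ℝ) {A : Type u} [MVAlgebra A]
    [ScalarMVAlgebra K A] (s : Set A) : MVAlgebra {x : A // ScalarMVClosure K s x} where
  nsmul := nsmulRec
  add_assoc x y z := Subtype.ext (add_assoc x.1 y.1 z.1)
  zero_add x := Subtype.ext (zero_add x.1)
  add_zero x := Subtype.ext (add_zero x.1)
  add_comm x y := Subtype.ext (add_comm x.1 y.1)
  mvNeg x := ⟨mvNeg x.1, .neg _ x.2⟩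
  mvNeg_mvNeg x := Subtype.ext (mvNeg_mvNeg x.1)
  mvNeg_zero_add x := Subtype.ext (mvNeg_zero_add x.1)
  mvNeg_add_comm x y := Subtype.ext (mvNeg_add_comm x.1 y.1)

instance instScalarMVAlgebraScalarMVClosure (K : Subfield ℝ) {A : Type u} [MVAlgebra A]
    [ScalarMVAlgebra K A] (s : Set A) : ScalarMVAlgebra K {x : A // ScalarMVClosure K s x} where
  smul r x := ⟨r • x.1, .smul _ _ x.2⟩
  smul_odot_neg r x y := Subtype.ext (ScalarMVAlgebra.smul_odot_neg r x.1 y.1)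
  odot_neg_smul r q x := Subtype.ext (ScalarMVAlgebra.odot_neg_smul r q x.1)
  smul_smul' r q x := Subtype.ext (ScalarMVAlgebra.smul_smul' r q x.1)
  one_smul' x := Subtype.ext (ScalarMVAlgebra.one_smul' (K := K) x.1)

/-! ### Free algebras and finite presentation -/

/-- The coordinate projections `[0,1]ⁿ → [0,1]`. -/
def cubeProjections (n : ℕ) : Set ((Fin n → unitInterval) → unitInterval) :=
  Set.range fun i x => x i

/-- The free MV-algebra `MV_n` on `n` generators: the MV-algebra of term functions
`[0,1]ⁿ → [0,1]`, freely generated by the projections (`[0,1]` generates the variety). -/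
def FreeMV (n : ℕ) : Type :=
  {f : (Fin n → unitInterval) → unitInterval // MVClosure (cubeProjections n) f}

noncomputable instance (n : ℕ) : MVAlgebra (FreeMV n) :=
  inferInstanceAs (MVAlgebra {f // MVClosure (cubeProjections n) f})

/-- The free algebra on `n` generators among the MV-algebras with scalars in `[0,1] ∩ K`, again as
an algebra of term functions: `DMV_n` for `K = ℚ` and `RMV_n` for `K = ℝ`. -/
def FreeScalarMV (K : Subfield ℝ) (n : ℕ) : Type :=
  {f : (Fin n → unitInterval) → unitInterval // ScalarMVClosure K (cubeProjections n) f}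

noncomputable instance (K : Subfield ℝ) (n : ℕ) : MVAlgebra (FreeScalarMV K n) :=
  inferInstanceAs (MVAlgebra {f // ScalarMVClosure K (cubeProjections n) f})

noncomputable instance (K : Subfield ℝ) (n : ℕ) : ScalarMVAlgebra K (FreeScalarMV K n) :=
  inferInstanceAs (ScalarMVAlgebra K {f // ScalarMVClosure K (cubeProjections n) f})

/-- `A` is finitely presented: it is a quotient `MV_n / (a]`, that is, there is a surjective
homomorphism `φ : MV_n → A` whose kernel congruence `φ f = φ g` is the congruence
`d(f, g) ∈ (a]` of a principal ideal. -/
def IsFinitelyPresentedMV (A : Type u) [MVAlgebra A] : Prop :=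
  ∃ (n : ℕ) (a : FreeMV n) (φ : MVHom (FreeMV n) A), Function.Surjective φ.toFun ∧
    ∀ f g : FreeMV n, φ.toFun f = φ.toFun g ↔ mvDist f g ∈ mvIdeal a

/-- Finite presentation of MV-algebras with scalar multiplication, defined in the same way. (The
ideals of such an algebra are those of its MV-algebra reduct.) -/
def IsFinitelyPresentedScalarMV (K : Subfield ℝ) (A : Type u) [MVAlgebra A]
    [ScalarMVAlgebra K A] : Prop :=
  ∃ (n : ℕ) (a : FreeScalarMV K n) (φ : ScalarMVHom K (FreeScalarMV K n) A),
    Function.Surjective φ.toFun ∧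
    ∀ f g : FreeScalarMV K n, φ.toFun f = φ.toFun g ↔ mvDist f g ∈ mvIdeal a

/-! ### The semisimple tensor product -/

/-- Bimorphisms of MV-algebras. -/
structure MVBimorphism (A : Type u) (B : Type v) (C : Type w)
    [MVAlgebra A] [MVAlgebra B] [MVAlgebra C] where
  toFun : A → B → C
  map_one_one : toFun mvOne mvOne = mvOne
  map_zero_left : ∀ b, toFun 0 b = 0
  map_zero_right : ∀ a, toFun a 0 = 0
  map_sup_left : ∀ a₁ a₂ b, toFun (mvSup a₁ a₂) b = mvSup (toFun a₁ b) (toFun a₂ b)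
  map_sup_right : ∀ a b₁ b₂, toFun a (mvSup b₁ b₂) = mvSup (toFun a b₁) (toFun a b₂)
  map_inf_left : ∀ a₁ a₂ b, toFun (mvInf a₁ a₂) b = mvInf (toFun a₁ b) (toFun a₂ b)
  map_inf_right : ∀ a b₁ b₂, toFun a (mvInf b₁ b₂) = mvInf (toFun a b₁) (toFun a b₂)
  map_add_left : ∀ a₁ a₂ b, odot a₁ a₂ = 0 →
    odot (toFun a₁ b) (toFun a₂ b) = 0 ∧ toFun (a₁ + a₂) b = toFun a₁ b + toFun a₂ b
  map_add_right : ∀ a b₁ b₂, odot b₁ b₂ = 0 →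
    odot (toFun a b₁) (toFun a b₂) = 0 ∧ toFun a (b₁ + b₂) = toFun a b₁ + toFun a b₂

/-- The element `a ⊗ b`, as the function that evaluates `[0,1]`-valued bimorphisms at `(a, b)`. -/
def pureTensorFun {A : Type u} {B : Type v} [MVAlgebra A] [MVAlgebra B] (a : A) (b : B) :
    MVBimorphism A B unitInterval → unitInterval := fun β => β.toFun a b

/-- The set of all `a ⊗ b`. -/
def pureTensors (A : Type u) (B : Type v) [MVAlgebra A] [MVAlgebra B] :
    Set (MVBimorphism A B unitInterval → unitInterval) :=
  {F | ∃ a b, F = pureTensorFun a b}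

/-- The semisimple tensor product `A ⊗ B`: the MV-algebra of functions generated by the `a ⊗ b`.
It is the largest semisimple quotient of the universal MV-algebra with a bimorphism from `A × B`,
since two elements of an MV-algebra are equal modulo its radical if and only if no homomorphism
to `[0,1]` separates them. Hence every bimorphism from `A × B` to a semisimple MV-algebra factors
uniquely through `(a, b) ↦ a ⊗ b`. -/
def MVTensor (A : Type u) (B : Type v) [MVAlgebra A] [MVAlgebra B] : Type (max u v) :=
  {F : MVBimorphism A B unitInterval → unitInterval // MVClosure (pureTensors A B) F}

noncomputable instance (A : Type u) (B : Type v) [MVAlgebra A] [MVAlgebra B] :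
    MVAlgebra (MVTensor A B) :=
  inferInstanceAs (MVAlgebra {F // MVClosure (pureTensors A B) F})

/-- The element `a ⊗ b` of `A ⊗ B`. -/
def MVTensor.tmul {A : Type u} {B : Type v} [MVAlgebra A] [MVAlgebra B] (a : A) (b : B) :
    MVTensor A B :=
  ⟨pureTensorFun a b, .of _ ⟨a, b, rfl⟩⟩

/-! ### The scalar multiplication on `([0,1] ∩ K) ⊗ A` -/

/-- An additive function on the scalars is linear. -/
theorem scalars_linear {K : Subfield ℝ} (f : Scalars K → unitInterval)
    (hf : ∀ r s, odot r s = 0 → odot (f r) (f s) = 0 ∧ f (r + s) = f r + f s) (r : Scalars K) :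
    (f r : ℝ) = (r.val : ℝ) * f mvOne := by
  have hadd : ∀ r s t : Scalars K, (t.val : ℝ) = (r.val : ℝ) + s.val →
      (f t : ℝ) = (f r : ℝ) + f s := by
    intro r s t h
    have ht := t.val.2.2
    have h0 : odot r s = 0 := by
      apply Scalars.ext
      apply Subtype.ext
      rw [Scalars.val_odot, unitInterval.mv_coe_odot, Scalars.val_zero, unitInterval.mv_coe_zero]
      exact max_eq_left (by linarith)
    have h1 : t = r + s := by
      apply Scalars.ext
      apply Subtype.ext
      rw [Scalars.val_add, unitInterval.mv_coe_add, min_eq_right (by linarith), h]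
    obtain ⟨h2, h3⟩ := hf r s h0
    have h4 := congrArg (Subtype.val : unitInterval → ℝ) h2
    rw [unitInterval.mv_coe_odot, unitInterval.mv_coe_zero] at h4
    have h5 : (f r : ℝ) + f s - 1 ≤ 0 := h4 ▸ le_max_right _ _
    rw [h1, h3, unitInterval.mv_coe_add]
    exact min_eq_right (by linarith)
  have hmono : ∀ r s : Scalars K, (r.val : ℝ) ≤ s.val → (f r : ℝ) ≤ f s := by
    intro r s h
    have hr := r.val.2.1
    have hs := s.val.2.2
    let t : Scalars K := ⟨⟨(s.val : ℝ) - r.val, by linarith, by linarith⟩, K.sub_mem s.2 r.2⟩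
    have h1 := hadd r t s (by change _ = (r.val : ℝ) + ((s.val : ℝ) - r.val); ring)
    have h2 := (f t).2.1
    linarith
  have hone : ((mvOne : Scalars K).val : ℝ) = 1 := unitInterval.mv_coe_one
  have hfrac : ∀ n : ℕ, 0 < n → ∀ m : ℕ, m ≤ n → ∀ t : Scalars K,
      (t.val : ℝ) = (m : ℝ) / n → (f t : ℝ) = (m : ℝ) / n * f mvOne := by
    intro n hn
    have hn' : (0 : ℝ) < n := Nat.cast_pos.2 hn
    have hn1 : (1 : ℝ) ≤ n := Nat.one_le_cast.2 hn
    let e : Scalars K := ⟨⟨(1 : ℝ) / n, by positivity, (div_le_one hn').2 hn1⟩,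
      K.div_mem K.one_mem (natCast_mem K n)⟩
    have key : ∀ m : ℕ, m ≤ n → ∀ t : Scalars K,
        (t.val : ℝ) = (m : ℝ) / n → (f t : ℝ) = m * f e := by
      intro m
      induction m with
      | zero =>
        intro _ t ht
        have h1 : (t.val : ℝ) = (t.val : ℝ) + t.val := by rw [ht]; simp
        have h2 := hadd t t t h1
        push_cast
        linarith
      | succ m ih =>
        intro hm t ht
        have hm' : (m : ℝ) ≤ n := by exact_mod_cast (Nat.le_of_succ_le hm)
        let t' : Scalars K := ⟨⟨(m : ℝ) / n, by positivity, (div_le_one hn').2 hm'⟩,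
          K.div_mem (natCast_mem K m) (natCast_mem K n)⟩
        have h1 := ih (Nat.le_of_succ_le hm) t' rfl
        have h2 := hadd t' e t (by
          rw [ht]
          change ((m + 1 : ℕ) : ℝ) / n = (m : ℝ) / n + 1 / n
          push_cast
          ring)
        push_cast
        linarith
    have h1 := key n le_rfl mvOne (by rw [hone, div_self hn'.ne'])
    intro m hm t ht
    rw [key m hm t ht, h1]
    field_simp
  have hF0 := (f mvOne).2.1
  have hF1 := (f mvOne).2.2
  have hr0 := r.val.2.1
  have hr1 := r.val.2.2
  have hbound : ∀ n : ℕ, 0 < n → |(f r : ℝ) - (r.val : ℝ) * f mvOne| ≤ 1 / n := by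
    intro n hn
    have hn' : (0 : ℝ) < n := Nat.cast_pos.2 hn
    set m := ⌊(r.val : ℝ) * n⌋₊ with hm
    have hm1 : (m : ℝ) ≤ (r.val : ℝ) * n := Nat.floor_le (by positivity)
    have hm2 : (r.val : ℝ) * n < m + 1 := Nat.lt_floor_add_one _
    have hmn : m ≤ n := by
      have : (m : ℝ) ≤ n := hm1.trans (by nlinarith)
      exact_mod_cast this
    have hmn' : (m : ℝ) ≤ n := by exact_mod_cast hmn
    have hlow : (m : ℝ) / n ≤ r.val := (div_le_iff₀ hn').2 hm1
    let a : Scalars K := ⟨⟨(m : ℝ) / n, by positivity, (div_le_one hn').2 hmn'⟩,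
      K.div_mem (natCast_mem K m) (natCast_mem K n)⟩
    have ha := hfrac n hn m hmn a rfl
    have ha' := hmono a r hlow
    have hup : (r.val : ℝ) ≤ (m : ℝ) / n + 1 / n := by
      rw [← add_div, le_div_iff₀ hn']
      exact hm2.le
    have hup' : (f r : ℝ) ≤ ((m : ℝ) / n + 1 / n) * f mvOne := by
      rcases Nat.lt_or_ge m n with h | h
      · have hb1 : ((m + 1 : ℕ) : ℝ) ≤ n := by exact_mod_cast h
        let b : Scalars K := ⟨⟨((m + 1 : ℕ) : ℝ) / n, by positivity, (div_le_one hn').2 hb1⟩,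
          K.div_mem (natCast_mem K (m + 1)) (natCast_mem K n)⟩
        have hb := hfrac n hn (m + 1) h b rfl
        have hb' := hmono r b (by
          refine hup.trans (le_of_eq ?_)
          change (m : ℝ) / n + 1 / n = ((m + 1 : ℕ) : ℝ) / n
          push_cast
          ring)
        rw [hb] at hb'
        refine hb'.trans (le_of_eq ?_)
        push_cast
        ring
      · have h1 : (m : ℝ) = n := by exact_mod_cast le_antisymm hmn h
        have h2 := hmono r mvOne (by rw [hone]; exact hr1)
        have h3 : (0 : ℝ) ≤ 1 / n := by positivity
        rw [h1, div_self hn'.ne']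
        nlinarith
    have hd : (0 : ℝ) ≤ 1 / n := by positivity
    rw [abs_le]
    constructor <;> nlinarith
  by_contra hne
  have hpos : 0 < |(f r : ℝ) - (r.val : ℝ) * f mvOne| := abs_pos.2 (sub_ne_zero.2 hne)
  obtain ⟨n, hn⟩ := exists_nat_one_div_lt hpos
  have := hbound (n + 1) n.succ_pos
  push_cast at this
  linarith

section Hull

variable {K : Subfield ℝ} {A : Type u} [MVAlgebra A]

theorem smul_pureTensorFun (r s : Scalars K) (a : A) :
    r • pureTensorFun s a = pureTensorFun (r * s) a := by
  funext β
  apply Subtype.ext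
  change (r.val : ℝ) * β.toFun s a = β.toFun (r * s) a
  have h := scalars_linear (fun t => β.toFun t a) (fun t t' => β.map_add_left t t' a)
  rw [h (r * s), h s, Scalars.val_mul, Set.Icc.coe_mul, mul_assoc]

theorem smul_one_eq_pureTensorFun (r : Scalars K) :
    r • (mvOne : MVBimorphism (Scalars K) A unitInterval → unitInterval)
      = pureTensorFun r mvOne := by
  funext β
  apply Subtype.ext
  change (r.val : ℝ) * (mvOne : unitInterval) = β.toFun r mvOne
  have h := scalars_linear (fun t => β.toFun t mvOne) (fun t t' => β.map_add_left t t' mvOne) r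
  rw [h]
  simp only [β.map_one_one]

theorem MVClosure.odot_mem {B : Type v} [MVAlgebra B] {s : Set B} {x y : B}
    (hx : MVClosure s x) (hy : MVClosure s y) : MVClosure s (odot x y) :=
  .neg _ (.add _ _ (.neg _ hx) (.neg _ hy))

theorem MVClosure.inf_mem {B : Type v} [MVAlgebra B] {s : Set B} {x y : B}
    (hx : MVClosure s x) (hy : MVClosure s y) : MVClosure s (mvInf x y) :=
  .neg _ (.add _ _ (.neg _ hx) (MVClosure.odot_mem (.neg _ hy) (.neg _ (.neg _ hx))))

/-- `([0,1] ∩ K) ⊗ A` is closed under the pointwise multiplication by scalars. -/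
theorem MVClosure.smul_mem (r : Scalars K)
    {F : MVBimorphism (Scalars K) A unitInterval → unitInterval}
    (hF : MVClosure (pureTensors (Scalars K) A) F) :
    MVClosure (pureTensors (Scalars K) A) (r • F) := by
  have hone : MVClosure (pureTensors (Scalars K) A)
      (r • (mvOne : MVBimorphism (Scalars K) A unitInterval → unitInterval)) := by
    rw [smul_one_eq_pureTensorFun]
    exact .of _ ⟨r, mvOne, rfl⟩
  induction hF with
  | of F hF =>
    obtain ⟨s, a, rfl⟩ := hF
    rw [smul_pureTensorFun]
    exact .of _ ⟨r * s, a, rfl⟩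
  | zero =>
    have h : r • (0 : MVBimorphism (Scalars K) A unitInterval → unitInterval) = 0 := by
      funext β
      apply Subtype.ext
      change (r.val : ℝ) * 0 = 0
      exact mul_zero _
    rw [h]
    exact .zero
  | add F G _ _ ihF ihG =>
    have h : r • (F + G) = mvInf (r • mvOne) (r • F + r • G) := by
      funext β
      apply Subtype.ext
      change (r.val : ℝ) * ((F β + G β : unitInterval) : ℝ)
        = (mvInf (r • mvOne) (r • F β + r • G β) : unitInterval)
      rw [unitInterval.mv_coe_inf, unitInterval.mv_coe_add, unitInterval.mv_coe_add,
        unitInterval.mv_coe_smul, unitInterval.mv_coe_smul, unitInterval.mv_coe_smul,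
        unitInterval.mv_coe_one]
      have h0 := r.val.2.1
      have h1 := r.val.2.2
      rw [mul_min_of_nonneg _ _ h0, mul_add, mul_one, ← min_assoc, min_eq_left h1]
    rw [h]
    exact MVClosure.inf_mem hone (.add _ _ ihF ihG)
  | neg F _ ihF =>
    have h : r • mvNeg F = odot (r • mvOne) (mvNeg (r • F)) := by
      rw [← ScalarMVAlgebra.smul_odot_neg]
      congr 1
      funext β
      apply Subtype.ext
      change ((mvNeg (F β) : unitInterval) : ℝ) = (odot mvOne (mvNeg (F β)) : unitInterval)
      rw [unitInterval.mv_coe_odot, unitInterval.mv_coe_one, add_sub_cancel_left,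
        max_eq_right (mvNeg (F β)).2.1]
    rw [h]
    exact MVClosure.odot_mem hone (.neg _ ihF)

end Hull

/-- The scalar multiplication on `([0,1] ∩ K) ⊗ A`, with `r (s ⊗ a) = (r s) ⊗ a`. -/
noncomputable instance (K : Subfield ℝ) (A : Type u) [MVAlgebra A] :
    ScalarMVAlgebra K (MVTensor (Scalars K) A) where
  smul r F := ⟨r • F.1, MVClosure.smul_mem r F.2⟩
  smul_odot_neg r F G := Subtype.ext (ScalarMVAlgebra.smul_odot_neg r F.1 G.1)
  odot_neg_smul r q F := Subtype.ext (ScalarMVAlgebra.odot_neg_smul r q F.1)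
  smul_smul' r q F := Subtype.ext (ScalarMVAlgebra.smul_smul' r q F.1)
  one_smul' F := Subtype.ext (ScalarMVAlgebra.one_smul' (K := K) F.1)

/-- The canonical map `ι_A : A → ([0,1] ∩ K) ⊗ A`, `ι_A a = 1 ⊗ a`. -/
noncomputable def MVTensor.incl (K : Subfield ℝ) {A : Type u} [MVAlgebra A] (a : A) :
    MVTensor (Scalars K) A := MVTensor.tmul mvOne a

/-! ### The categories -/

/-- The category of MV-algebras. -/
structure MVAlgCat : Type (u + 1) where
  carrier : Type u
  [str : MVAlgebra carrier]

attribute [instance] MVAlgCat.str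

instance : Category MVAlgCat.{u} where
  Hom A B := MVHom A.carrier B.carrier
  id A := ⟨fun x => x, rfl, fun _ _ => rfl, fun _ => rfl⟩
  comp f g := ⟨fun x => g.toFun (f.toFun x), by rw [f.map_zero, g.map_zero],
    fun x y => by rw [f.map_add, g.map_add], fun x => by rw [f.map_neg, g.map_neg]⟩

/-- The category of MV-algebras with scalars in `[0,1] ∩ K`: the category **DMV** for `K = ℚ` and
**RMV** for `K = ℝ`. -/
structure ScalarMVAlgCat (K : Subfield ℝ) : Type (u + 1) where
  carrier : Type u
  [str : MVAlgebra carrier]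
  [scalarStr : ScalarMVAlgebra K carrier]

attribute [instance] ScalarMVAlgCat.str ScalarMVAlgCat.scalarStr

instance (K : Subfield ℝ) : Category (ScalarMVAlgCat.{u} K) where
  Hom A B := ScalarMVHom K A.carrier B.carrier
  id A := ⟨⟨fun x => x, rfl, fun _ _ => rfl, fun _ => rfl⟩, fun _ _ => rfl⟩
  comp f g := ⟨⟨fun x => g.toFun (f.toFun x), by rw [f.map_zero, g.map_zero],
    fun x y => by rw [f.map_add, g.map_add], fun x => by rw [f.map_neg, g.map_neg]⟩,
    fun r x => by
      change g.toFun (f.toFun (r • x)) = r • g.toFun (f.toFun x)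
      rw [f.map_smul, g.map_smul]⟩

/-- The full subcategory **MV_fp** of finitely presented MV-algebras. -/
abbrev MVfp : Type (u + 1) :=
  ObjectProperty.FullSubcategory fun A : MVAlgCat.{u} => IsFinitelyPresentedMV A.carrier

/-- The tensor hull `([0,1] ∩ K) ⊗ A`. -/
noncomputable def tensorHull (K : Subfield ℝ) (A : MVAlgCat.{u}) : ScalarMVAlgCat.{u} K :=
  ⟨MVTensor (Scalars K) A.carrier⟩

/-- The functor `D_⊗` on objects: `D_⊗(A) = ([0,1] ∩ ℚ) ⊗ A`. -/
noncomputable abbrev Dtensor (A : MVAlgCat.{u}) : ScalarMVAlgCat.{u} ratScalars :=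
  tensorHull ratScalars A

/-- The functor `T_⊗` on objects: `T_⊗(A) = [0,1] ⊗ A`. -/
noncomputable abbrev Ttensor (A : MVAlgCat.{u}) : ScalarMVAlgCat.{u} realScalars :=
  tensorHull realScalars A

/-- The canonical map `ι_A` from `A` to its tensor hull. -/
noncomputable def hullIncl (K : Subfield ℝ) (A : MVAlgCat.{u}) (a : A.carrier) : (tensorHull K A).carrier :=
  MVTensor.incl K a

/-- `g` preserves the MV-elements: `g(ι_A(A)) ⊆ ι_B(B)`. -/
def PreservesMVElements {K : Subfield ℝ} {A B : MVAlgCat.{u}}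
    (g : tensorHull K A ⟶ tensorHull K B) : Prop :=
  MVHom.toFun (ScalarMVHom.toMVHom g) '' Set.range (hullIncl K A) ⊆ Set.range (hullIncl K B)

/-- The category whose objects are the tensor hulls `([0,1] ∩ K) ⊗ A` of finitely presented
MV-algebras `A`; an object is recorded by `A`, since the morphisms refer to `ι_A`. -/
structure TensorHullCat (K : Subfield ℝ) : Type (u + 1) where
  base : MVfp.{u}

namespace TensorHullCat

variable {K : Subfield ℝ}

/-- The algebra `([0,1] ∩ K) ⊗ A`. -/
noncomputable def alg (X : TensorHullCat.{u} K) : ScalarMVAlgCat.{u} K := tensorHull K X.base.obj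

/-- Morphisms: the homomorphisms of hulls (preserving scalar multiplication) that preserve the
MV-elements. -/
@[ext]
structure Hom (X Y : TensorHullCat.{u} K) where
  hom : X.alg ⟶ Y.alg
  preserves : PreservesMVElements hom

noncomputable instance : Category (TensorHullCat.{u} K) where
  Hom X Y := Hom X Y
  id X := ⟨𝟙 X.alg, by
    rintro _ ⟨x, hx, rfl⟩
    exact hx⟩
  comp f g := ⟨f.hom ≫ g.hom, by
    rintro _ ⟨x, hx, rfl⟩
    exact g.preserves ⟨_, f.preserves ⟨x, hx, rfl⟩, rfl⟩⟩

end TensorHullCat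

/-- **DMV'_fp**: the DMV-algebras `D_⊗(A)`, `A` a finitely presented MV-algebra, with the
DMV-homomorphisms that preserve the MV-elements. -/
abbrev DMVfp' : Type (u + 1) := TensorHullCat.{u} ratScalars

/-- **RMV'_fp**: the Riesz MV-algebras `T_⊗(A)`, `A` a finitely presented MV-algebra, with the
homomorphisms of Riesz MV-algebras that preserve the MV-elements. -/
abbrev RMVfp' : Type (u + 1) := TensorHullCat.{u} realScalars

/-! ### Farkas' lemma -/

/-! Let A = MV_n / (a], and let Z be the zero set of a in the cube [0,1]ⁿ. Term functions, with or
without scalars, are piecewise linear. Over each cell of a finite polyhedral cover, Farkas' lemma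
bounds a function vanishing on Z by a multiple of a (`IsPiecewiseLinear.exists_le_mul`). Hence f and
g are congruent modulo (a] exactly when they agree on Z (`mvDist_mem_mvIdeal_iff_of_separating`). So
A is the algebra of restrictions to Z of term functions, and its homomorphisms to [0,1] are the
points of Z.

A bimorphism β from ([0,1] ∩ K) × A to [0,1] has the form β(r, x) = r h(x) with h a homomorphism
(`MVBimorphism.coe_toFun`, `MVHom.scalarBimorphism`). Bimorphisms are therefore again the points of
Z, whatever K is, and the tensor hull becomes the algebra of restrictions to Z of term functions
with scalars. It is presented by the same relator a, and ι_A is an inclusion of function algebras.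

An MV-homomorphism acts on hulls by precomposing bimorphisms. Since r ⊗ x = r(1 ⊗ x), a homomorphism
out of a hull is determined on ι_A(A). If it preserves MV-elements, injectivity of ι_B makes it
restrict to an MV-homomorphism from A to B. Thus the hull functor is fully faithful, and it is
essentially surjective by the choice of objects. All this holds for every subfield K of ℝ; the
theorem takes K = ℚ and K = ℝ. -/

/-- Farkas' lemma: a linear functional that is nonnegative wherever finitely many functionals are
nonnegative is a conical combination of them. -/
theorem exists_conical_combination {ι E : Type*} [AddCommGroup E] [Module ℝ E] (s : Finset ι)
    (g : ι → E →ₗ[ℝ] ℝ) (l : E →ₗ[ℝ] ℝ) (h : ∀ x, (∀ i ∈ s, 0 ≤ g i x) → 0 ≤ l x) :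
    ∃ c : ι → ℝ, (∀ i, 0 ≤ c i) ∧ l = ∑ i ∈ s, c i • g i := by
  classical
  induction s using Finset.induction_on generalizing g l with
  | empty =>
    refine ⟨0, fun _ => le_rfl, LinearMap.ext fun x => ?_⟩
    have h1 := h x (by simp)
    have h2 := h (-x) (by simp)
    rw [map_neg] at h2
    simp only [Finset.sum_empty, LinearMap.zero_apply]
    linarith
  | insert k s hk ih =>
    -- If the constraint `k` is redundant, it gets coefficient zero. Otherwise some `y` satisfies
    -- the constraints in `s` with `l y < 0`; it must then violate `k`, and one can project along
    -- `y` onto the kernel of `g k`.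
    by_cases hs : ∀ x, (∀ i ∈ s, 0 ≤ g i x) → 0 ≤ l x
    · obtain ⟨c, hc, hl⟩ := ih g l hs
      refine ⟨Function.update c k 0, fun i => ?_, ?_⟩
      · rcases eq_or_ne i k with rfl | hi
        · simp
        · simpa [hi] using hc i
      · rw [Finset.sum_insert hk, Function.update_self, zero_smul, zero_add, hl]
        refine Finset.sum_congr rfl fun i hi => ?_
        rw [Function.update_of_ne (ne_of_mem_of_not_mem hi hk)]
    · push Not at hs
      obtain ⟨y, hy, hly⟩ := hs
      have hky : g k y < 0 := by
        by_contra hky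
        exact absurd (h y (Finset.forall_mem_insert _ _ _ |>.2 ⟨not_lt.1 hky, hy⟩)) (not_le.2 hly)
      -- These are the old functionals composed with the projection x ↦ x - (g k x / g k y) y, whose
      -- values satisfy the constraint `k` with equality.
      obtain ⟨c, hc, hl⟩ := ih (fun i => g i - (g i y / g k y) • g k) (l - (l y / g k y) • g k)
        (fun x hx => by
          have := h (x - (g k x / g k y) • y) (Finset.forall_mem_insert _ _ _ |>.2 ⟨by
              simp only [map_sub, map_smul, smul_eq_mul]
              rw [div_mul_cancel₀ _ hky.ne, sub_self], fun i hi => by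
              have := hx i hi
              simp only [LinearMap.sub_apply, LinearMap.smul_apply, map_sub, map_smul,
                smul_eq_mul] at this ⊢
              exact this.trans_eq (by ring)⟩)
          simp only [LinearMap.sub_apply, LinearMap.smul_apply, map_sub, map_smul,
            smul_eq_mul] at this ⊢
          exact this.trans_eq (by ring))
      -- Undoing the projection collects all multiples of `g k` in one coefficient. It is
      -- nonnegative because `l y` and `g k y` are negative while all `c i` and `g i y` with `i ∈ s`
      -- are nonnegative.
      refine ⟨Function.update c k (l y / g k y - ∑ i ∈ s, c i * (g i y / g k y)), fun i => ?_, ?_⟩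
      · rcases eq_or_ne i k with rfl | hi
        · rw [Function.update_self, sub_nonneg]
          exact (Finset.sum_nonpos fun j hj => mul_nonpos_of_nonneg_of_nonpos (hc j)
            (div_nonpos_of_nonneg_of_nonpos (hy j hj) hky.le)).trans
            (div_nonneg_of_nonpos hly.le hky.le)
        · simpa [hi] using hc i
      · have h1 : ∑ i ∈ s, Function.update c k
            (l y / g k y - ∑ i ∈ s, c i * (g i y / g k y)) i • g i = ∑ i ∈ s, c i • g i :=
          Finset.sum_congr rfl fun i hi => by
            rw [Function.update_of_ne (ne_of_mem_of_not_mem hi hk)]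
        refine (eq_add_of_sub_eq hl).trans ?_
        rw [Finset.sum_insert hk, Function.update_self, h1]
        ext x
        simp only [LinearMap.add_apply, LinearMap.sum_apply, LinearMap.smul_apply,
          LinearMap.sub_apply, smul_eq_mul, mul_sub, Finset.sum_sub_distrib, sub_mul,
          Finset.sum_mul, mul_assoc]
        ring

/-- On a polyhedral cone, a functional that is nonpositive where `m` is nonpositive is bounded by
a multiple of `m`. -/
theorem exists_le_mul_of_nonpos {E : Type*} [AddCommGroup E] [Module ℝ E]
    (C : Finset (E →ₗ[ℝ] ℝ)) (l m : E →ₗ[ℝ] ℝ)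
    (h : ∀ x, (∀ g ∈ C, 0 ≤ g x) → m x ≤ 0 → l x ≤ 0) :
    ∃ c : ℝ, ∀ x, (∀ g ∈ C, 0 ≤ g x) → l x ≤ c * m x := by
  -- Farkas for `-l`, with `-m` adjoined as the constraint `none`; the coefficient of `-m` is the
  -- required constant.
  obtain ⟨c, hc, hl⟩ := exists_conical_combination (Finset.insertNone C)
    (fun o => o.elim (-m) id) (-l) (fun x hx => by
      have h1 := hx none (by simp)
      have h2 := h x (fun g hg => hx (some g) (by simpa using hg)) (by simpa using h1)
      simpa using h2)
  refine ⟨c none, fun x hx => ?_⟩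
  have h1 := congrArg (fun f : E →ₗ[ℝ] ℝ => f x) hl
  simp only [Finset.sum_insertNone, Option.elim_none, Option.elim_some, id, LinearMap.neg_apply,
    LinearMap.add_apply, LinearMap.smul_apply, LinearMap.sum_apply, smul_eq_mul] at h1
  have h2 : 0 ≤ ∑ g ∈ C, c (some g) * g x :=
    Finset.sum_nonneg fun g hg => mul_nonneg (hc _) (hx g hg)
  linarith

/-! ### Piecewise linear functions on the cube -/

/-- The homogeneous coordinates `(1, x)` of a point `x` of the cube. -/
def homogeneousPoint {n : ℕ} (x : Fin n → unitInterval) : ℝ × (Fin n → ℝ) :=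
  (1, fun i => x i)

/-- `f` is piecewise linear: the cube is covered by finitely many polyhedra, and on each of them
`f` agrees with an affine function. Affine functions are written as linear functionals of the
homogeneous coordinates. -/
def IsPiecewiseLinear {n : ℕ} (f : (Fin n → unitInterval) → unitInterval) : Prop :=
  ∃ (ι : Type) (_ : Finite ι) (C : ι → Finset (ℝ × (Fin n → ℝ) →ₗ[ℝ] ℝ))
    (l : ι → ℝ × (Fin n → ℝ) →ₗ[ℝ] ℝ),
    (∀ x, ∃ i, ∀ g ∈ C i, 0 ≤ g (homogeneousPoint x)) ∧
    ∀ i x, (∀ g ∈ C i, 0 ≤ g (homogeneousPoint x)) → (f x : ℝ) = l i (homogeneousPoint x)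

/-- Negation and scalars only change the linear pieces, whose coefficients may be any reals; only
the truncated sum refines the cells. -/
theorem ScalarMVClosure.isPiecewiseLinear {K : Subfield ℝ} {n : ℕ}
    {f : (Fin n → unitInterval) → unitInterval} (hf : ScalarMVClosure K (cubeProjections n) f) :
    IsPiecewiseLinear f := by
  classical
  induction hf with
  | of f hf =>
    obtain ⟨i, rfl⟩ := hf
    exact ⟨Unit, inferInstance, fun _ => ∅, fun _ => LinearMap.proj i ∘ₗ LinearMap.snd ℝ ℝ _,
      fun _ => ⟨(), by simp⟩, fun _ _ _ => rfl⟩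
  | zero => exact ⟨Unit, inferInstance, fun _ => ∅, fun _ => 0, fun _ => ⟨(), by simp⟩,
      fun _ _ _ => rfl⟩
  | add f g _ _ ihf ihg =>
    obtain ⟨ι, _, C, l, hC, hl⟩ := ihf
    obtain ⟨κ, _, D, m, hD, hm⟩ := ihg
    -- The Boolean records the active side of the truncation: `true` where the untruncated sum is at
    -- least 1.
    refine ⟨(ι × κ) × Bool, inferInstance,
      fun q => insert (bif q.2 then l q.1.1 + m q.1.2 - LinearMap.fst ℝ ℝ _
        else LinearMap.fst ℝ ℝ _ - (l q.1.1 + m q.1.2)) (C q.1.1 ∪ D q.1.2),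
      fun q => bif q.2 then LinearMap.fst ℝ ℝ _ else l q.1.1 + m q.1.2, fun x => ?_, ?_⟩
    · obtain ⟨i, hi⟩ := hC x
      obtain ⟨j, hj⟩ := hD x
      have hij : ∀ g ∈ C i ∪ D j, 0 ≤ g (homogeneousPoint x) := fun g hg =>
        (Finset.mem_union.1 hg).elim (hi g) (hj g)
      rcases le_total 1 (l i (homogeneousPoint x) + m j (homogeneousPoint x)) with h | h
      · exact ⟨((i, j), true), (Finset.forall_mem_insert _ _ _).2 ⟨sub_nonneg.2 h, hij⟩⟩
      · exact ⟨((i, j), false), (Finset.forall_mem_insert _ _ _).2 ⟨sub_nonneg.2 h, hij⟩⟩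
    · rintro ⟨⟨i, j⟩, b⟩ x hx
      obtain ⟨hb, hx⟩ := (Finset.forall_mem_insert _ _ _).1 hx
      change min 1 ((f x : ℝ) + g x) = _
      rw [hl i x fun g hg => hx g (Finset.mem_union_left _ hg),
        hm j x fun g hg => hx g (Finset.mem_union_right _ hg)]
      cases b
      · exact min_eq_right (sub_nonneg.1 hb)
      · exact min_eq_left (sub_nonneg.1 hb)
  | neg f _ ih =>
    obtain ⟨ι, _, C, l, hC, hl⟩ := ih
    refine ⟨ι, inferInstance, C, fun i => LinearMap.fst ℝ ℝ _ - l i, hC, fun i x hx => ?_⟩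
    change 1 - (f x : ℝ) = 1 - l i _
    rw [hl i x hx]
  | smul r f _ ih =>
    obtain ⟨ι, _, C, l, hC, hl⟩ := ih
    refine ⟨ι, inferInstance, C, fun i => (r.val : ℝ) • l i, hC, fun i x hx => ?_⟩
    change (r.val : ℝ) * f x = r.val * l i _
    rw [hl i x hx]

/-- A piecewise linear function that vanishes on the zeros of `a` is bounded by a multiple
of `a`. -/
theorem IsPiecewiseLinear.exists_le_mul {n : ℕ} {f a : (Fin n → unitInterval) → unitInterval}
    (hf : IsPiecewiseLinear f) (ha : IsPiecewiseLinear a)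
    (h : ∀ x, a x = 0 → f x = 0) : ∃ N : ℕ, ∀ x, (f x : ℝ) ≤ N * a x := by
  classical
  obtain ⟨ι, _, C, l, hC, hl⟩ := hf
  obtain ⟨κ, _, D, m, hD, hm⟩ := ha
  let coord : Fin n → ℝ × (Fin n → ℝ) →ₗ[ℝ] ℝ := fun i => LinearMap.proj i ∘ₗ LinearMap.snd ℝ ℝ _
  -- The cone over the cube: its slice `z.1 = 1` is the cube, and only the apex has `z.1 = 0`.
  -- Homogenizing makes the linear form of Farkas' lemma applicable.
  let cube : Finset (ℝ × (Fin n → ℝ) →ₗ[ℝ] ℝ) := insert (LinearMap.fst ℝ ℝ _)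
    (Finset.univ.image coord ∪ Finset.univ.image fun i => LinearMap.fst ℝ ℝ _ - coord i)
  have hcube : ∀ z, (∀ g ∈ cube, 0 ≤ g z) ↔ 0 ≤ z.1 ∧ ∀ i, 0 ≤ z.2 i ∧ z.2 i ≤ z.1 := by
    intro z
    simp [cube, coord, or_imp, forall_and]
  have key : ∀ q : ι × κ, ∃ N : ℕ, ∀ x, (∀ g ∈ C q.1, 0 ≤ g (homogeneousPoint x)) →
      (∀ g ∈ D q.2, 0 ≤ g (homogeneousPoint x)) → (f x : ℝ) ≤ N * a x := by
    rintro ⟨i, j⟩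
    obtain ⟨c, hc⟩ := exists_le_mul_of_nonpos (cube ∪ (C i ∪ D j)) (l i) (m j) (by
      intro z hz hmz
      simp only [Finset.mem_union, or_imp, forall_and] at hz
      obtain ⟨hz1, hzC, hzD⟩ := hz
      obtain ⟨h0, hz1⟩ := (hcube z).1 hz1
      rcases h0.eq_or_lt with h0 | h0
      · have : z = 0 := Prod.ext h0.symm (funext fun k => le_antisymm ((hz1 k).2.trans_eq h0.symm)
          (hz1 k).1)
        rw [this, map_zero]
      -- Off the apex, `z` rescales to a point of the cube, where `l i` and `m j` compute `f` and
      -- `a`. Then `m j z ≤ 0` forces `a x = 0`, hence `f x = 0`.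
      · let x : Fin n → unitInterval := fun k =>
          ⟨z.2 k / z.1, div_nonneg (hz1 k).1 h0.le, (div_le_one h0).2 (hz1 k).2⟩
        have hx : homogeneousPoint x = z.1⁻¹ • z := by
          refine Prod.ext ?_ (funext fun k => ?_)
          · exact (inv_mul_cancel₀ h0.ne').symm
          · exact div_eq_inv_mul _ _
        have hinv : 0 ≤ z.1⁻¹ := inv_nonneg.2 h0.le
        have hfx := hl i x fun g hg => by
          rw [hx, map_smul]; exact mul_nonneg hinv (hzC g hg)
        have hax := hm j x fun g hg => by
          rw [hx, map_smul]; exact mul_nonneg hinv (hzD g hg)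
        rw [hx, map_smul, smul_eq_mul] at hfx hax
        have ha0 : a x = 0 := Subtype.ext (le_antisymm
          (hax.trans_le (mul_nonpos_of_nonneg_of_nonpos hinv hmz)) (a x).2.1)
        rw [h x ha0] at hfx
        have : l i z = 0 := by
          rcases mul_eq_zero.1 hfx.symm with h1 | h1
          · exact absurd h1 (inv_ne_zero h0.ne')
          · exact h1
        exact this.le)
    -- Rounding `c` up keeps the bound because `a` is nonnegative.
    refine ⟨⌈c⌉₊, fun x hxC hxD => ?_⟩
    rw [hl i x hxC]
    refine (hc (homogeneousPoint x) fun g hg => ?_).trans ?_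
    · rcases Finset.mem_union.1 hg with hg | hg
      · exact (hcube _).2 ⟨zero_le_one, fun k => ⟨(x k).2.1, (x k).2.2⟩⟩ g hg
      · exact (Finset.mem_union.1 hg).elim (hxC g) (hxD g)
    · rw [← hm j x hxD]
      exact mul_le_mul_of_nonneg_right (Nat.le_ceil c) (a x).2.1
  choose N hN using key
  obtain ⟨M, hM⟩ := Finite.exists_le N
  refine ⟨M, fun x => ?_⟩
  obtain ⟨i, hi⟩ := hC x
  obtain ⟨j, hj⟩ := hD x
  exact (hN (i, j) x hi hj).trans
    (mul_le_mul_of_nonneg_right (Nat.cast_le.2 (hM (i, j))) (a x).2.1)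

/-! ### Homomorphisms and the derived operations -/

namespace MVAlgebra

variable {A : Type u} [MVAlgebra A]

theorem mvNeg_one : mvNeg (mvOne : A) = 0 := mvNeg_mvNeg 0

theorem one_add' (x : A) : mvOne + x = mvOne := mvNeg_zero_add x

theorem mvNeg_add_self (x : A) : mvNeg x + x = mvOne := by
  have h := mvNeg_add_comm mvOne x
  rwa [mvNeg_one, zero_add, add_comm (mvNeg (mvNeg x + mvOne)), one_add'] at h

theorem odot_mvNeg_self (x : A) : odot x (mvNeg x) = 0 := by
  rw [odot, mvNeg_mvNeg, mvNeg_add_self, mvNeg_one]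

theorem mvInf_mvNeg_eq (x y : A) : mvInf (mvNeg x) y = mvNeg (x + mvNeg (y + x)) := by
  rw [mvInf, mvSup, odot, mvNeg_mvNeg, mvNeg_mvNeg, mvNeg_mvNeg]

theorem odot_mvInf_mvNeg (x y : A) : odot x (mvInf (mvNeg x) y) = 0 := by
  rw [mvInf_mvNeg_eq, odot, mvNeg_mvNeg, ← add_assoc, mvNeg_add_self, one_add', mvNeg_one]

/-- With `odot_mvInf_mvNeg`, this writes any truncated sum as a sum of orthogonal elements, the only
sums that bimorphisms are assumed to respect. -/
theorem add_mvInf_mvNeg (x y : A) : x + mvInf (mvNeg x) y = x + y := by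
  rw [mvInf_mvNeg_eq, add_comm x, add_comm x, mvNeg_add_comm, add_comm y x,
    ← add_assoc (mvNeg x), mvNeg_add_self, one_add', mvNeg_one, zero_add, add_comm]

end MVAlgebra

namespace MVHom

variable {A : Type u} {B : Type v} [MVAlgebra A] [MVAlgebra B] (h : MVHom A B)

theorem map_one : h.toFun mvOne = mvOne := by
  rw [mvOne, h.map_neg, h.map_zero, mvOne]

theorem map_odot (x y : A) : h.toFun (odot x y) = odot (h.toFun x) (h.toFun y) := by
  simp only [odot, h.map_neg, h.map_add]

theorem map_sup (x y : A) : h.toFun (mvSup x y) = mvSup (h.toFun x) (h.toFun y) := by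
  simp only [mvSup, h.map_odot, h.map_neg, h.map_add]

theorem map_inf (x y : A) : h.toFun (mvInf x y) = mvInf (h.toFun x) (h.toFun y) := by
  simp only [mvInf, h.map_sup, h.map_neg]

theorem map_dist (x y : A) : h.toFun (mvDist x y) = mvDist (h.toFun x) (h.toFun y) := by
  simp only [mvDist, h.map_odot, h.map_neg, h.map_add]

theorem map_nsmul (n : ℕ) (x : A) : h.toFun (n • x) = n • h.toFun x := by
  induction n with
  | zero => rw [zero_nsmul, zero_nsmul, h.map_zero]
  | succ n ih => rw [succ_nsmul, succ_nsmul, h.map_add, ih]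

/-- Composition of homomorphisms. -/
def comp {C : Type w} [MVAlgebra C] (g : MVHom B C) (f : MVHom A B) : MVHom A C where
  toFun x := g.toFun (f.toFun x)
  map_zero := by rw [f.map_zero, g.map_zero]
  map_add x y := by rw [f.map_add, g.map_add]
  map_neg x := by rw [f.map_neg, g.map_neg]

end MVHom

namespace unitInterval

theorem mv_coe_sup (x y : unitInterval) : ((mvSup x y : unitInterval) : ℝ) = max (x : ℝ) y := by
  have h1 := x.2.2
  have h2 := y.2.2
  have h3 := x.2.1
  have h4 := y.2.1
  simp only [mvSup, mv_coe_neg, mv_coe_add, mv_coe_odot]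
  simp only [min_def, max_def]
  split_ifs <;> linarith

theorem mv_coe_dist (x y : unitInterval) : ((mvDist x y : unitInterval) : ℝ) = |(x : ℝ) - y| := by
  have h1 := x.2.2
  have h2 := y.2.2
  have h3 := x.2.1
  have h4 := y.2.1
  simp only [mvDist, mv_coe_neg, mv_coe_add, mv_coe_odot]
  rcases abs_cases ((x : ℝ) - y) with ⟨h, _⟩ | ⟨h, _⟩ <;> rw [h] <;>
    simp only [min_def, max_def] <;> split_ifs <;> linarith

theorem mv_coe_nsmul (n : ℕ) (x : unitInterval) :
    ((n • x : unitInterval) : ℝ) = min 1 (n * (x : ℝ)) := by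
  induction n with
  | zero =>
    rw [zero_nsmul, mv_coe_zero, Nat.cast_zero, zero_mul, min_eq_right zero_le_one]
  | succ n ih =>
    rw [succ_nsmul, mv_coe_add, ih, Nat.cast_succ, add_mul, one_mul]
    have := x.2.1
    simp only [min_def]
    split_ifs <;> linarith

theorem mvLe_iff {x y : unitInterval} : mvLe x y ↔ (x : ℝ) ≤ y := by
  rw [mvLe, ← Subtype.coe_inj, mv_coe_sup, max_eq_right_iff]

theorem mvDist_eq_zero {x y : unitInterval} : mvDist x y = 0 ↔ x = y := by
  rw [← Subtype.coe_inj, mv_coe_dist, mv_coe_zero, abs_eq_zero, sub_eq_zero, Subtype.coe_inj]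

end unitInterval

/-! ### Principal ideals of free algebras -/

/-- An element of an algebra of functions lies in the ideal of `a` if and only if it is bounded by
a multiple of `a`. -/
theorem mem_mvIdeal_iff_of_separating {B : Type u} {X : Type v} [MVAlgebra B]
    (ev : X → MVHom B unitInterval)
    (hev : ∀ f g : B, (∀ x, (ev x).toFun f = (ev x).toFun g) → f = g) (f a : B) :
    f ∈ mvIdeal a ↔ ∃ N : ℕ, ∀ x, ((ev x).toFun f : ℝ) ≤ N * (ev x).toFun a := by
  refine exists_congr fun N => ⟨fun h x => ?_, fun h => hev _ _ fun x => ?_⟩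
  · have h1 := congrArg (ev x).toFun h
    rw [MVHom.map_sup, MVHom.map_nsmul] at h1
    have h2 := unitInterval.mvLe_iff.1 h1
    rw [unitInterval.mv_coe_nsmul] at h2
    exact h2.trans (min_le_right _ _)
  · rw [MVHom.map_sup, MVHom.map_nsmul]
    refine unitInterval.mvLe_iff.2 ?_
    rw [unitInterval.mv_coe_nsmul]
    -- The multiple `N • a` is truncated at 1, which costs nothing since `f` has values at most 1.
    exact le_min ((ev x).toFun f).2.2 (h x)

/-- The distance evaluates to |f - g|, which is piecewise linear, so vanishing on the zeros of `a`
already gives a bound by a multiple of `a`. Stating this for an abstract algebra with evaluations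
serves the free algebras with and without scalars. -/
theorem mvDist_mem_mvIdeal_iff_of_separating {B : Type u} {n : ℕ} [MVAlgebra B]
    (ev : (Fin n → unitInterval) → MVHom B unitInterval)
    (hev : ∀ f g : B, (∀ x, (ev x).toFun f = (ev x).toFun g) → f = g)
    (hpl : ∀ f : B, IsPiecewiseLinear fun x => (ev x).toFun f) (f g a : B) :
    mvDist f g ∈ mvIdeal a ↔
      ∀ x, (ev x).toFun a = 0 → (ev x).toFun f = (ev x).toFun g := by
  rw [mem_mvIdeal_iff_of_separating ev hev]
  constructor
  · rintro ⟨N, hN⟩ x hx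
    have h1 := hN x
    rw [hx, unitInterval.mv_coe_zero, mul_zero, MVHom.map_dist] at h1
    exact unitInterval.mvDist_eq_zero.1 (Subtype.ext (le_antisymm h1 (unitInterval.nonneg _)))
  · intro h
    refine (hpl _).exists_le_mul (hpl a) fun x hx => ?_
    rw [MVHom.map_dist]
    exact unitInterval.mvDist_eq_zero.2 (h x hx)

theorem MVClosure.scalarMVClosure (K : Subfield ℝ) {A : Type u} [MVAlgebra A]
    [ScalarMVAlgebra K A] {s : Set A} {x : A} (hx : MVClosure s x) : ScalarMVClosure K s x := by
  induction hx with
  | of x hx => exact .of x hx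
  | zero => exact .zero
  | add x y _ _ hx hy => exact .add x y hx hy
  | neg x _ hx => exact .neg x hx

/-- The `i`-th generator of the free MV-algebra. -/
def FreeMV.gen {n : ℕ} (i : Fin n) : FreeMV n := ⟨fun x => x i, .of _ ⟨i, rfl⟩⟩

/-- Evaluation of term functions at a point of the cube. -/
def FreeMV.eval {n : ℕ} (x : Fin n → unitInterval) : MVHom (FreeMV n) unitInterval where
  toFun f := f.1 x
  map_zero := rfl
  map_add _ _ := rfl
  map_neg _ := rfl

/-- Evaluation of term functions at a point of the cube. -/
def FreeScalarMV.eval {K : Subfield ℝ} {n : ℕ} (x : Fin n → unitInterval) :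
    MVHom (FreeScalarMV K n) unitInterval where
  toFun f := f.1 x
  map_zero := rfl
  map_add _ _ := rfl
  map_neg _ := rfl

/-- Every homomorphism from the free MV-algebra to `[0,1]` is the evaluation at a point. -/
theorem FreeMV.hom_eq_eval {n : ℕ} (h : MVHom (FreeMV n) unitInterval) (f : FreeMV n) :
    h.toFun f = f.1 fun i => h.toFun (FreeMV.gen i) := by
  obtain ⟨f, hf⟩ := f
  induction hf with
  | of f hf =>
    obtain ⟨i, rfl⟩ := hf
    rfl
  | zero => exact h.map_zero
  | add f g hf hg ihf ihg =>
    exact (h.map_add ⟨f, hf⟩ ⟨g, hg⟩).trans (congrArg₂ (· + ·) ihf ihg)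
  | neg f hf ih => exact (h.map_neg ⟨f, hf⟩).trans (congrArg mvNeg ih)

theorem FreeMV.mvDist_mem_mvIdeal_iff {n : ℕ} (f g a : FreeMV n) :
    mvDist f g ∈ mvIdeal a ↔ ∀ x, a.1 x = 0 → f.1 x = g.1 x :=
  mvDist_mem_mvIdeal_iff_of_separating FreeMV.eval (fun _ _ h => Subtype.ext (funext h))
    (fun f => (f.2.scalarMVClosure ⊤).isPiecewiseLinear) f g a

theorem FreeScalarMV.mvDist_mem_mvIdeal_iff {K : Subfield ℝ} {n : ℕ} (f g a : FreeScalarMV K n) :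
    mvDist f g ∈ mvIdeal a ↔ ∀ x, a.1 x = 0 → f.1 x = g.1 x :=
  mvDist_mem_mvIdeal_iff_of_separating FreeScalarMV.eval (fun _ _ h => Subtype.ext (funext h))
    (fun f => f.2.isPiecewiseLinear) f g a

/-! ### Bimorphisms to the unit interval -/

section Bimorphism

variable {K : Subfield ℝ} {A : Type u} [MVAlgebra A]

/-- The elements x and x* are orthogonal with sum 1. Orthogonality of their images gives a real sum
at most 1, and additivity gives at least 1. -/
theorem MVBimorphism.map_neg_right (β : MVBimorphism (Scalars K) A unitInterval) (x : A) :
    β.toFun mvOne (mvNeg x) = mvNeg (β.toFun mvOne x) := by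
  obtain ⟨h1, h2⟩ := β.map_add_right mvOne x (mvNeg x) (odot_mvNeg_self x)
  rw [add_comm x, mvNeg_add_self, β.map_one_one] at h2
  have h3 := congrArg (Subtype.val : unitInterval → ℝ) h1
  have h4 := congrArg (Subtype.val : unitInterval → ℝ) h2
  rw [unitInterval.mv_coe_odot, unitInterval.mv_coe_zero] at h3
  rw [unitInterval.mv_coe_one, unitInterval.mv_coe_add] at h4
  apply Subtype.ext
  rw [unitInterval.mv_coe_neg]
  have h5 := max_eq_left_iff.1 h3
  have h6 := min_eq_left_iff.1 h4.symm
  linarith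

/-- The homomorphism `β (1, -)` of a bimorphism `β`. -/
noncomputable def MVBimorphism.rightHom (β : MVBimorphism (Scalars K) A unitInterval) :
    MVHom A unitInterval where
  toFun a := β.toFun mvOne a
  map_zero := β.map_zero_right _
  map_add x y := by
    -- Replace y by x* ∧ y to make the sum orthogonal, then apply the same identity in [0,1] to
    -- remove the replacement.
    have h := (β.map_add_right mvOne x (mvInf (mvNeg x) y) (odot_mvInf_mvNeg x y)).2
    rwa [add_mvInf_mvNeg, β.map_inf_right, β.map_neg_right, add_mvInf_mvNeg] at h
  map_neg x := β.map_neg_right x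

/-- Additivity in the scalar already forces linearity (`scalars_linear`), so a bimorphism is
determined by the homomorphism β(1, -). -/
theorem MVBimorphism.coe_toFun (β : MVBimorphism (Scalars K) A unitInterval) (r : Scalars K)
    (a : A) : (β.toFun r a : ℝ) = r.val * β.rightHom.toFun a :=
  scalars_linear (fun t => β.toFun t a) (fun t t' => β.map_add_left t t' a) r

theorem MVBimorphism.toFun_eq (β : MVBimorphism (Scalars K) A unitInterval) (r : Scalars K)
    (a : A) : β.toFun r a = r • β.rightHom.toFun a :=
  Subtype.ext (β.coe_toFun r a)

theorem Scalars.val_sup (r s : Scalars K) : (mvSup r s).val = mvSup r.val s.val := rfl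

theorem Scalars.val_inf (r s : Scalars K) : (mvInf r s).val = mvInf r.val s.val := rfl

/-- The bimorphism `(r, a) ↦ r h(a)` of a homomorphism `h`. -/
noncomputable def MVHom.scalarBimorphism (K : Subfield ℝ) (h : MVHom A unitInterval) :
    MVBimorphism (Scalars K) A unitInterval where
  toFun r a := r • h.toFun a
  map_one_one := by rw [ScalarMVAlgebra.one_smul', h.map_one]
  map_zero_left a := Subtype.ext (zero_mul _)
  map_zero_right r := by rw [h.map_zero]; exact Subtype.ext (mul_zero _)
  map_sup_left r s a := Subtype.ext (by
    rw [unitInterval.mv_coe_sup]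
    simp only [unitInterval.mv_coe_smul]
    rw [Scalars.val_sup, unitInterval.mv_coe_sup, max_mul_of_nonneg _ _ (h.toFun a).2.1])
  map_sup_right r a b := Subtype.ext (by
    rw [unitInterval.mv_coe_sup]
    simp only [unitInterval.mv_coe_smul]
    rw [h.map_sup, unitInterval.mv_coe_sup, mul_max_of_nonneg _ _ r.val.2.1])
  map_inf_left r s a := Subtype.ext (by
    rw [unitInterval.mv_coe_inf]
    simp only [unitInterval.mv_coe_smul]
    rw [Scalars.val_inf, unitInterval.mv_coe_inf, min_mul_of_nonneg _ _ (h.toFun a).2.1])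
  map_inf_right r a b := Subtype.ext (by
    rw [unitInterval.mv_coe_inf]
    simp only [unitInterval.mv_coe_smul]
    rw [h.map_inf, unitInterval.mv_coe_inf, mul_min_of_nonneg _ _ r.val.2.1])
  map_add_left r s a hrs := by
    have h1 := congrArg (fun t : Scalars K => (t.val : ℝ)) hrs
    simp only [Scalars.val_odot, unitInterval.mv_coe_odot, Scalars.val_zero,
      unitInterval.mv_coe_zero] at h1
    have h2 := max_eq_left_iff.1 h1
    have h3 := (h.toFun a).2
    have h4 : (r.val : ℝ) * h.toFun a + s.val * h.toFun a ≤ 1 := by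
      rw [← add_mul]
      exact mul_le_one₀ (by linarith) h3.1 h3.2
    refine ⟨Subtype.ext ?_, Subtype.ext ?_⟩
    · rw [unitInterval.mv_coe_odot, unitInterval.mv_coe_smul, unitInterval.mv_coe_smul]
      exact max_eq_left (by linarith)
    · rw [unitInterval.mv_coe_add, unitInterval.mv_coe_smul, unitInterval.mv_coe_smul,
        unitInterval.mv_coe_smul, Scalars.val_add, unitInterval.mv_coe_add,
        min_eq_right (by linarith), min_eq_right h4, add_mul]
  map_add_right r a b hab := by
    have h1 := congrArg (fun t : A => (h.toFun t : ℝ)) hab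
    simp only [h.map_odot, unitInterval.mv_coe_odot, h.map_zero, unitInterval.mv_coe_zero] at h1
    have h2 := max_eq_left_iff.1 h1
    have h3 := r.val.2
    have h4 : (r.val : ℝ) * h.toFun a + r.val * h.toFun b ≤ 1 := by
      rw [← mul_add]
      exact mul_le_one₀ h3.2 (add_nonneg (h.toFun a).2.1 (h.toFun b).2.1) (by linarith)
    refine ⟨Subtype.ext ?_, Subtype.ext ?_⟩
    · rw [unitInterval.mv_coe_odot, unitInterval.mv_coe_smul, unitInterval.mv_coe_smul]
      exact max_eq_left (by linarith)
    · rw [unitInterval.mv_coe_add, unitInterval.mv_coe_smul, unitInterval.mv_coe_smul,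
        unitInterval.mv_coe_smul, h.map_add, unitInterval.mv_coe_add,
        min_eq_right (by linarith), min_eq_right h4, mul_add]

end Bimorphism

/-! ### Presentations and the tensor hull -/

/-- A presentation `MV_n / (a]` of an MV-algebra. -/
structure MVPresentation (A : Type u) [MVAlgebra A] (n : ℕ) where
  rel : FreeMV n
  proj : MVHom (FreeMV n) A
  surjective : Function.Surjective proj.toFun
  proj_eq_iff : ∀ f g, proj.toFun f = proj.toFun g ↔ mvDist f g ∈ mvIdeal rel

namespace MVPresentation

variable {A : Type u} [MVAlgebra A] {n : ℕ} {K : Subfield ℝ}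

theorem proj_eq_iff_forall (P : MVPresentation A n) (f g : FreeMV n) :
    P.proj.toFun f = P.proj.toFun g ↔ ∀ x, P.rel.1 x = 0 → f.1 x = g.1 x :=
  (P.proj_eq_iff f g).trans (FreeMV.mvDist_mem_mvIdeal_iff f g P.rel)

theorem proj_rel (P : MVPresentation A n) : P.proj.toFun P.rel = 0 := by
  rw [← P.proj.map_zero]
  exact (P.proj_eq_iff_forall _ _).2 fun _ h => h

/-- The point of the cube that corresponds to a bimorphism. -/
noncomputable def point (P : MVPresentation A n) (β : MVBimorphism (Scalars K) A unitInterval) :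
    Fin n → unitInterval :=
  fun i => β.rightHom.toFun (P.proj.toFun (FreeMV.gen i))

theorem rightHom_proj (P : MVPresentation A n) (β : MVBimorphism (Scalars K) A unitInterval)
    (f : FreeMV n) :
    β.rightHom.toFun (P.proj.toFun f) = f.1 (P.point β) :=
  FreeMV.hom_eq_eval (β.rightHom.comp P.proj) f

theorem rel_point (P : MVPresentation A n) (β : MVBimorphism (Scalars K) A unitInterval) :
    P.rel.1 (P.point β) = 0 := by
  rw [← P.rightHom_proj, P.proj_rel, β.rightHom.map_zero]

/-- The homomorphism to `[0,1]` given by a zero of the relator. -/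
noncomputable def homOfPoint (P : MVPresentation A n) (x : Fin n → unitInterval)
    (hx : P.rel.1 x = 0) :
    MVHom A unitInterval :=
  -- The value at `x` does not depend on the chosen representative, because congruent term functions
  -- agree at zeros of the relator.
  have key : ∀ f, (Function.surjInv P.surjective (P.proj.toFun f)).1 x = f.1 x := fun f =>
    (P.proj_eq_iff_forall _ f).1 (Function.surjInv_eq P.surjective _) x hx
  { toFun := fun y => (Function.surjInv P.surjective y).1 x
    map_zero := by
      rw [← P.proj.map_zero, key]
      rfl
    map_add := fun y z => by
      obtain ⟨f, rfl⟩ := P.surjective y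
      obtain ⟨g, rfl⟩ := P.surjective z
      rw [← P.proj.map_add, key, key, key]
      rfl
    map_neg := fun y => by
      obtain ⟨f, rfl⟩ := P.surjective y
      rw [← P.proj.map_neg, key, key]
      rfl }

theorem homOfPoint_proj (P : MVPresentation A n) (x : Fin n → unitInterval) (hx : P.rel.1 x = 0)
    (f : FreeMV n) :
    (P.homOfPoint x hx).toFun (P.proj.toFun f) = f.1 x :=
  (P.proj_eq_iff_forall _ f).1 (Function.surjInv_eq P.surjective _) x hx

/-- Converse to `rel_point`: the points of bimorphisms fill the whole zero set of the relator. -/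
theorem exists_point_eq (P : MVPresentation A n) (K : Subfield ℝ) (x : Fin n → unitInterval)
    (hx : P.rel.1 x = 0) :
    ∃ β : MVBimorphism (Scalars K) A unitInterval, P.point β = x := by
  refine ⟨(P.homOfPoint x hx).scalarBimorphism K, funext fun i => ?_⟩
  change (mvOne : Scalars K) • (P.homOfPoint x hx).toFun _ = _
  rw [ScalarMVAlgebra.one_smul', P.homOfPoint_proj]
  rfl

/-- Finite presentation is essential here: it makes `A` semisimple, so that its homomorphisms to
[0,1] separate elements. -/
theorem incl_injective (P : MVPresentation A n) (K : Subfield ℝ) :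
    Function.Injective (MVTensor.incl K : A → MVTensor (Scalars K) A) := by
  intro y z h
  obtain ⟨f, rfl⟩ := P.surjective y
  obtain ⟨g, rfl⟩ := P.surjective z
  refine (P.proj_eq_iff_forall f g).2 fun x hx => ?_
  obtain ⟨β, rfl⟩ := P.exists_point_eq K x hx
  rw [← P.rightHom_proj, ← P.rightHom_proj]
  exact congrFun (congrArg Subtype.val h) β

/-- Each coordinate pulls back to a pure tensor 1 ⊗ a, and the hull is closed under scalars by
`MVClosure.smul_mem`. This makes `hullProj` well defined. -/
theorem mvClosure_comp_point (P : MVPresentation A n) {f : (Fin n → unitInterval) → unitInterval}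
    (hf : ScalarMVClosure K (cubeProjections n) f) :
    MVClosure (pureTensors (Scalars K) A) fun β => f (P.point β) := by
  induction hf with
  | of f hf =>
    obtain ⟨i, rfl⟩ := hf
    exact .of _ ⟨mvOne, P.proj.toFun (FreeMV.gen i), rfl⟩
  | zero => exact .zero
  | add f g _ _ hf hg => exact .add _ _ hf hg
  | neg f _ hf => exact .neg _ hf
  | smul r f _ hf => exact MVClosure.smul_mem r hf

/-- Surjectivity of `hullProj`: if a term function f represents y, then r f represents r ⊗ y. -/
theorem exists_comp_point (P : MVPresentation A n)
    {F : MVBimorphism (Scalars K) A unitInterval → unitInterval}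
    (hF : MVClosure (pureTensors (Scalars K) A) F) :
    ∃ f, ScalarMVClosure K (cubeProjections n) f ∧ ∀ β, f (P.point β) = F β := by
  induction hF with
  | of F hF =>
    obtain ⟨r, y, rfl⟩ := hF
    obtain ⟨f, rfl⟩ := P.surjective y
    refine ⟨r • f.1, .smul _ _ (f.2.scalarMVClosure K), fun β => ?_⟩
    change r • f.1 (P.point β) = β.toFun r _
    rw [β.toFun_eq, P.rightHom_proj]
  | zero => exact ⟨0, .zero, fun _ => rfl⟩
  | add F G _ _ hF hG =>
    obtain ⟨f, hf, hF⟩ := hF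
    obtain ⟨g, hg, hG⟩ := hG
    exact ⟨f + g, .add _ _ hf hg, fun β => congrArg₂ (· + ·) (hF β) (hG β)⟩
  | neg F _ hF =>
    obtain ⟨f, hf, hF⟩ := hF
    exact ⟨mvNeg f, .neg _ hf, fun β => congrArg mvNeg (hF β)⟩

/-- The projection of the free algebra with scalars onto the tensor hull. -/
noncomputable def hullProj (P : MVPresentation A n) (K : Subfield ℝ) :
    ScalarMVHom K (FreeScalarMV K n) (MVTensor (Scalars K) A) where
  toFun f := ⟨fun β => f.1 (P.point β), P.mvClosure_comp_point f.2⟩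
  map_zero := rfl
  map_add _ _ := rfl
  map_neg _ := rfl
  map_smul _ _ := rfl

/-- The relator of `A` also presents the hull: elements of the hull are functions on its zero set,
and agreement there is congruence modulo its ideal in the free algebra with scalars. -/
theorem isFinitelyPresented_hull (P : MVPresentation A n) (K : Subfield ℝ) :
    IsFinitelyPresentedScalarMV K (MVTensor (Scalars K) A) := by
  refine ⟨n, ⟨P.rel.1, P.rel.2.scalarMVClosure K⟩, P.hullProj K, ?_, fun f g => ?_⟩
  · rintro ⟨F, hF⟩
    obtain ⟨f, hf, h⟩ := P.exists_comp_point hF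
    exact ⟨⟨f, hf⟩, Subtype.ext (funext h)⟩
  · refine Iff.trans ?_ (FreeScalarMV.mvDist_mem_mvIdeal_iff f g _).symm
    refine ⟨fun h x hx => ?_, fun h => Subtype.ext (funext fun β => h _ (P.rel_point β))⟩
    obtain ⟨β, rfl⟩ := P.exists_point_eq K x hx
    exact congrFun (congrArg Subtype.val h) β

end MVPresentation

theorem IsFinitelyPresentedMV.exists_presentation {A : Type u} [MVAlgebra A]
    (h : IsFinitelyPresentedMV A) : ∃ n, Nonempty (MVPresentation A n) :=
  let ⟨n, a, φ, h1, h2⟩ := h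
  ⟨n, ⟨⟨a, φ, h1, h2⟩⟩⟩

theorem IsFinitelyPresentedMV.tensorHull {A : MVAlgCat.{u}} (h : IsFinitelyPresentedMV A.carrier)
    (K : Subfield ℝ) : IsFinitelyPresentedScalarMV K (tensorHull K A).carrier :=
  let ⟨_, ⟨P⟩⟩ := h.exists_presentation
  P.isFinitelyPresented_hull K

theorem IsFinitelyPresentedMV.hullIncl_injective {A : MVAlgCat.{u}}
    (h : IsFinitelyPresentedMV A.carrier) (K : Subfield ℝ) :
    Function.Injective (hullIncl K A) :=
  let ⟨_, ⟨P⟩⟩ := h.exists_presentation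
  P.incl_injective K

/-! ### Functoriality of the tensor hull -/

section Functoriality

variable {K : Subfield ℝ} {A B : Type u} [MVAlgebra A] [MVAlgebra B]

/-- Restriction of a bimorphism along a homomorphism in the second argument. -/
noncomputable def MVBimorphism.compRight (β : MVBimorphism (Scalars K) B unitInterval)
    (f : MVHom A B) :
    MVBimorphism (Scalars K) A unitInterval where
  toFun r a := β.toFun r (f.toFun a)
  map_one_one := by rw [f.map_one, β.map_one_one]
  map_zero_left a := β.map_zero_left _
  map_zero_right r := by rw [f.map_zero, β.map_zero_right]
  map_sup_left r s a := β.map_sup_left r s _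
  map_sup_right r a b := by rw [f.map_sup, β.map_sup_right]
  map_inf_left r s a := β.map_inf_left r s _
  map_inf_right r a b := by rw [f.map_inf, β.map_inf_right]
  map_add_left r s a h := β.map_add_left r s _ h
  map_add_right r a b h := by
    rw [f.map_add]
    exact β.map_add_right r _ _ (by rw [← f.map_odot, h, f.map_zero])

/-- The homomorphism of tensor hulls induced by a homomorphism of MV-algebras. -/
noncomputable def MVTensor.map (K : Subfield ℝ) (f : MVHom A B) :
    ScalarMVHom K (MVTensor (Scalars K) A) (MVTensor (Scalars K) B) where
  toFun F := ⟨fun β => F.1 (β.compRight f), by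
    obtain ⟨F, hF⟩ := F
    induction hF with
    | of F hF =>
      obtain ⟨r, a, rfl⟩ := hF
      exact .of _ ⟨r, f.toFun a, rfl⟩
    | zero => exact .zero
    | add F G _ _ hF hG => exact .add _ _ hF hG
    | neg F _ hF => exact .neg _ hF⟩
  map_zero := rfl
  map_add _ _ := rfl
  map_neg _ := rfl
  map_smul _ _ := rfl

/-- The canonical map of `A` to its tensor hull is a homomorphism. -/
noncomputable def MVTensor.inclHom (K : Subfield ℝ) (A : Type u) [MVAlgebra A] :
    MVHom A (MVTensor (Scalars K) A) where
  toFun := MVTensor.incl K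
  map_zero := Subtype.ext (funext fun β => β.rightHom.map_zero)
  map_add a b := Subtype.ext (funext fun β => β.rightHom.map_add a b)
  map_neg a := Subtype.ext (funext fun β => β.rightHom.map_neg a)

theorem MVTensor.tmul_eq_smul_incl (r : Scalars K) (a : A) :
    MVTensor.tmul r a = r • MVTensor.incl K a :=
  Subtype.ext (funext fun β => β.toFun_eq r a)

/-- The pure tensors generate the hull, and each is a scalar multiple of an MV-element. -/
theorem MVTensor.hom_ext {C : Type w} [MVAlgebra C] [ScalarMVAlgebra K C]
    {g h : ScalarMVHom K (MVTensor (Scalars K) A) C}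
    (H : ∀ a, g.toFun (MVTensor.incl K a) = h.toFun (MVTensor.incl K a)) : g = h := by
  have key : ∀ F, g.toFun F = h.toFun F := by
    rintro ⟨F, hF⟩
    induction hF with
    | of F hF =>
      obtain ⟨r, a, rfl⟩ := hF
      change g.toFun (MVTensor.tmul r a) = h.toFun (MVTensor.tmul r a)
      rw [MVTensor.tmul_eq_smul_incl, g.map_smul, h.map_smul, H]
    | zero => exact g.map_zero.trans h.map_zero.symm
    | add F G hF hG ihF ihG =>
      exact (g.map_add ⟨F, hF⟩ ⟨G, hG⟩).trans
        ((congrArg₂ (· + ·) ihF ihG).trans (h.map_add ⟨F, hF⟩ ⟨G, hG⟩).symm)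
    | neg F hF ih =>
      exact (g.map_neg ⟨F, hF⟩).trans ((congrArg mvNeg ih).trans (h.map_neg ⟨F, hF⟩).symm)
  obtain ⟨⟨g, _, _, _⟩, _⟩ := g
  obtain ⟨⟨h, _, _, _⟩, _⟩ := h
  obtain rfl : g = h := funext key
  rfl

end Functoriality

/-! ### The hull functor and the equivalence -/

theorem MVHom.ext {A : Type u} {B : Type v} [MVAlgebra A] [MVAlgebra B] {f g : MVHom A B}
    (h : ∀ x, f.toFun x = g.toFun x) : f = g := by
  obtain ⟨f, _, _, _⟩ := f
  obtain ⟨g, _, _, _⟩ := g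
  obtain rfl : f = g := funext h
  rfl

/-- The tensor hull, as a functor on finitely presented MV-algebras. -/
noncomputable def hullFunctor (K : Subfield ℝ) : MVfp.{u} ⥤ TensorHullCat.{u} K where
  obj A := ⟨A⟩
  map {A B} f := ⟨MVTensor.map K (A := A.obj.carrier) (B := B.obj.carrier) f.hom, by
    rintro _ ⟨_, ⟨a, rfl⟩, rfl⟩
    exact ⟨MVHom.toFun f.hom a, rfl⟩⟩
  map_id _ := rfl
  map_comp _ _ := rfl

/-- On MV-elements the hull map is the original homomorphism followed by the injection ι_B. -/
instance (K : Subfield ℝ) : (hullFunctor.{u} K).Faithful where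
  map_injective {A B} f g h := by
    refine ObjectProperty.hom_ext _ (MVHom.ext fun a => B.property.hullIncl_injective K ?_)
    exact congrArg (fun t => MVHom.toFun (ScalarMVHom.toMVHom (TensorHullCat.Hom.hom t))
      (hullIncl K A.obj a)) h

/-- Preservation of MV-elements and injectivity of ι_B restrict `g` to a map from A to B. Its hull
agrees with `g` on MV-elements, hence everywhere. -/
instance (K : Subfield ℝ) : (hullFunctor.{u} K).Full where
  map_surjective {A B} g := by
    have hinj := B.property.hullIncl_injective K
    have hg : ∀ a, ∃ b, hullIncl K B.obj b =
        MVHom.toFun (ScalarMVHom.toMVHom g.hom) (hullIncl K A.obj a) :=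
      fun a => g.preserves ⟨_, ⟨a, rfl⟩, rfl⟩
    choose f hf using hg
    -- Both sides are now values of homomorphisms, so their laws pass to `f` through the injection.
    have hf : ∀ a, (MVTensor.inclHom K B.obj.carrier).toFun (f a) =
        (MVHom.comp (ScalarMVHom.toMVHom g.hom) (MVTensor.inclHom K A.obj.carrier)).toFun a := hf
    let φ : MVHom A.obj.carrier B.obj.carrier :=
      { toFun := f
        map_zero := hinj ((hf 0).trans ((MVHom.map_zero _).trans
          (MVTensor.inclHom K _).map_zero.symm))
        map_add := fun x y => hinj ((hf _).trans ((MVHom.map_add _ _ _).trans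
          ((congrArg₂ (· + ·) (hf x) (hf y)).symm.trans ((MVTensor.inclHom K _).map_add _ _).symm)))
        map_neg := fun x => hinj ((hf _).trans ((MVHom.map_neg _ _).trans
          ((congrArg mvNeg (hf x)).symm.trans ((MVTensor.inclHom K _).map_neg _).symm))) }
    exact ⟨⟨φ⟩, TensorHullCat.Hom.ext (MVTensor.hom_ext fun a => hf a)⟩

instance (K : Subfield ℝ) : (hullFunctor.{u} K).EssSurj where
  mem_essImage X := ⟨X.base, ⟨Iso.refl X⟩⟩

/-- Finitely presented MV-algebras are equivalent to their tensor hulls. -/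
noncomputable def hullEquivalence (K : Subfield ℝ) : MVfp.{u} ≌ TensorHullCat.{u} K :=
  haveI : (hullFunctor.{u} K).IsEquivalence := {}
  (hullFunctor K).asEquivalence

/-- The hulls of finitely presented MV-algebras are finitely presented, so that `DMVfp'` and
`RMVfp'` are categories of finitely presented DMV- and Riesz MV-algebras; and the three categories
are equivalent. -/
theorem mainTheorem9 :
    (∀ A : MVfp.{u}, IsFinitelyPresentedScalarMV ratScalars (Dtensor A.obj).carrier) ∧
    (∀ A : MVfp.{u}, IsFinitelyPresentedScalarMV realScalars (Ttensor A.obj).carrier) ∧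
    Nonempty (MVfp.{u} ≌ DMVfp'.{u}) ∧
    Nonempty (MVfp.{u} ≌ RMVfp'.{u}) ∧
    Nonempty (DMVfp'.{u} ≌ RMVfp'.{u}) :=
  ⟨fun A => A.property.tensorHull _, fun A => A.property.tensorHull _, ⟨hullEquivalence _⟩,
    ⟨hullEquivalence _⟩, ⟨(hullEquivalence _).symm.trans (hullEquivalence _)⟩⟩
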